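/- For a group $G$ and a homomorphism $\phi\colon G\to\mathbb{Q}$ let $$\mathbb{Z}_\phi[G]]=\{\,f\colon G\to\mathbb{Z} \mid \text{for every } C\in\mathbb{R} \text{ there are only finitely many } g\in G \text{ with } f(g)\neq 0 \text{ and } \phi(g)<C\,\},$$ viewed as a left $\mathbb{Z}[G]$-module by left multiplication of the formal sums $\sum_{x} f(x)\,x$, that is, $(g\cdot f)(x)=f(g^{-1}x)$. For a finitely generated group $G$, the (rational) Bieri–Neumann–Strebel invariant $\Sigma(G)$ is the set of all non-zero $\chi\in\operatorname{Hom}(G,\mathbb{Q})$ for which there are a finitely generated submonoid $P$ of $\{g\in G\mid \chi(g)\ge 0\}$ and a finite set $F\subset [G,G]$ such that $[G,G]$ is generated as a group by the elements $p^{-1}xp$ with $p\in P$, $x\in F$. We say that $(G,\phi)$ is represented by an ascending HNN extension if there are a finitely generated group $B$, a monomorphism $\gamma\colon B\to B$ and an isomorphism $G\cong\langle B,t\mid tbt^{-1}=\gamma(b)\text{ for all } b\in B\rangle$ under which $\phi$ is positive on $t$ and zero on $B$. **Theorem.** Let $\pi$ be a finitely presented group and let $\phi\in\operatorname{Hom}(\pi,\mathbb{Q})$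 be non-zero. If $H_1(\pi;\mathbb{Z}_\phi[\pi]])=0$, then $\phi\in\Sigma(\pi)$, and $(\pi,\phi)$ is represented by an ascending HNN extension. -/

import Mathlib

universe u

/-- The Novikov-Sikorav completion `ℤ_φ[G]]` of the group ring `ℤ[G]` along `φ : G → ℚ`, as an
additive group: all functions `f : G → ℤ` such that for every real `C` there are only finitely
many `g` with `f g ≠ 0` and `φ g < C`. -/
def novikov {G : Type u} [Group G] (φ : G →* Multiplicative ℚ) : Submodule ℤ (G → ℤ) where
  carrier := {f | ∀ C : ℝ, {g : G | f g ≠ 0 ∧ (((φ g).toAdd : ℚ) : ℝ) < C}.Finite}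
  zero_mem' := by
    intro C
    simp
  add_mem' := by
    intro f₁ f₂ h₁ h₂ C
    refine ((h₁ C).union (h₂ C)).subset ?_
    rintro g ⟨hg, hC⟩
    by_cases h : f₁ g = 0
    · refine Or.inr ⟨fun h' => hg ?_, hC⟩
      simp [h, h']
    · exact Or.inl ⟨h, hC⟩
  smul_mem' := by
    intro c f h C
    refine (h C).subset ?_
    rintro g ⟨hg, hC⟩
    refine ⟨fun h' => hg ?_, hC⟩
    simp [h']

/-- Left multiplication by group elements preserves the Novikov-Sikorav completion. -/
theorem novikov_translate_mem {G : Type u} [Group G] (φ : G →* Multiplicative ℚ) (g : G)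
    {f : G → ℤ} (hf : f ∈ novikov φ) : (fun x => f (g⁻¹ * x)) ∈ novikov φ := by
  intro C
  refine ((hf (C - (((φ g).toAdd : ℚ) : ℝ))).image (fun x => g * x)).subset ?_
  rintro x ⟨hx, hC⟩
  refine ⟨g⁻¹ * x, ⟨hx, ?_⟩, by simp⟩
  simp only [map_mul, map_inv, toAdd_mul, toAdd_inv]
  push_cast
  linarith

/-- `ℤ_φ[G]]` as a left `ℤ[G]`-module (a `ℤ`-linear representation of `G`): writing `f` as the
formal sum `∑ₓ f(x) x`, the element `g` acts by left multiplication,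
`g · ∑ₓ f(x) x = ∑ₓ f(x) gx = ∑ₓ f(g⁻¹x) x`.
The ring `ℤ` appears as its copy `ULift ℤ` in the universe of `G` only because Mathlib's group
homology asks for the ring of coefficients and the group to lie in the same universe. -/
def novikovRep {G : Type u} [Group G] (φ : G →* Multiplicative ℚ) :
    Representation (ULift.{u} ℤ) G (novikov φ) where
  toFun g :=
    { toFun := fun f => ⟨fun x => f.1 (g⁻¹ * x), novikov_translate_mem φ g f.2⟩
      map_add' := fun _ _ => rfl
      map_smul' := fun _ _ => rfl }
  map_one' := by
    ext f x
    simp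
  map_mul' g h := by
    ext f x
    simp [mul_assoc]

/-- The first Novikov-Sikorav homology `H₁(G; ℤ_φ[G]])`: group homology of `G` with coefficients
in the left `ℤ[G]`-module `ℤ_φ[G]]`. -/
noncomputable abbrev novikovH1 {G : Type u} [Group G] (φ : G →* Multiplicative ℚ) :
    ModuleCat.{u} (ULift.{u} ℤ) :=
  groupHomology (Rep.of (novikovRep φ)) 1

/-- The (rational) Bieri-Neumann-Strebel invariant `Σ(G)`: the set of all non-zero `χ : G → ℚ`
such that, for the right conjugation action `x ↦ p⁻¹xp` of `G` on its commutator subgroup, the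
commutator subgroup is finitely generated over some finitely generated submonoid `P` of
`{g | 0 ≤ χ g}`, that is, it is generated as a group by the `P`-orbits of a finite subset. -/
def bnsInvariant (G : Type u) [Group G] : Set (G →* Multiplicative ℚ) :=
  {χ | χ ≠ 1 ∧ ∃ P : Submonoid G, P.FG ∧ (∀ p ∈ P, 0 ≤ (χ p).toAdd) ∧
    ∃ F : Finset G, (∀ x ∈ F, x ∈ commutator G) ∧
      Subgroup.closure {y : G | ∃ p ∈ P, ∃ x ∈ F, y = p⁻¹ * x * p} = commutator G}

/-- The pair `(G, φ)` is represented by an ascending HNN-extension: there are a finitely generated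
group `B`, a subgroup `A` of `B` which is all of `B`, a monomorphism `γ : A → B` (an isomorphism
onto its image `A'`), and an isomorphism from `G` to `⟨B, t | t a t⁻¹ = γ(a) for all a ∈ A⟩` under
which `φ` is positive on the stable letter `t` and zero on `B`. -/
def IsRepresentedByAscendingHNN {G : Type u} [Group G] (φ : G →* Multiplicative ℚ) : Prop :=
  ∃ (B : Type u) (_ : Group B) (A A' : Subgroup B) (γ : A ≃* A') (e : G ≃* HNNExtension B A A' γ),
    Group.FG B ∧ A = ⊤ ∧
      0 < (φ (e.symm HNNExtension.t)).toAdd ∧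
      ∀ b : B, (φ (e.symm (HNNExtension.of b))).toAdd = 0

/-!
# Vanishing of first Novikov-Sikorav homology and ascending HNN extensions

Since `π` is finitely generated, `φ` is a positive multiple of a surjection `ψ : π → ℤ`
(`exists_integral_character`); fix `t` with `ψ t = 1` and write `K` for the kernel.

The homological hypothesis enters once. Let `H` be a subgroup such that for every `g` the element
`t⁻ʰ (g t^(-ψ g)) tʰ` of `K` lies in `H` for all large `h`, and let `l` be the indicator function
of `{x | t^(-ψ x) x ∈ H}`. For fixed `g` the difference `l (g⁻¹ x) - l x` vanishes once `φ x` is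
large, so it can be paired with elements of the Novikov-Sikorav completion. These pairings form a
1-cocycle, which kills all 1-cycles because `H₁ = 0`. Evaluated on the cycle made of an edge from
`1` to `s` and the two rays `1, t, t², …` and `s, ts, t²s, …`, it gives `l s - l 1`, the rays
contributing nothing as `l (t x) = l x`. Hence `l` is constant (`eq_of_novikovH1_isZero`), and
`K ≤ H` (`ker_le_of_eventually_kernelConj_mem`).

Take for `H` the subgroup generated by the elements `t⁻ʰ s tʰ` with `h ≥ 1`, where `s` runs through
the kernel parts of a finite generating set of `π`. The finitely many `s` lie in `H`, hence in the
subgroup generated by the `t⁻ʰ s tʰ` with `1 ≤ h ≤ M` for some `M`. So the finitely generated group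
`B` generated by the `t⁻ʰ s tʰ` with `0 ≤ h ≤ M` satisfies `t B t⁻¹ ≤ B`, and `B` and `t` generate
`π` (`exists_finset_base`). Normal forms `t⁻ⁿ b tᵐ` then identify `π` with the ascending HNN
extension of `B` (`isRepresentedByAscendingHNN_of_base`), and the commutators of the generators of
`B` with each other and with `t` generate the commutator subgroup over the monoid generated by `B`
and `t` (`mem_bnsInvariant_of_base`).
-/

/-! ### Cocycles and first homology -/

section Homology

open groupHomology

/-- A family of functionals `θ g : A → ℤ` satisfying the 1-cocycle identity vanishes on 1-boundaries;
hence it vanishes on all 1-cycles as soon as `H₁(G; A) = 0`. -/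
theorem cocycle_eval_eq_zero {k G : Type u} [CommRing k] [Group G] {A : Rep k G}
    (hA : CategoryTheory.Limits.IsZero (groupHomology A 1)) (θ : G → A →+ ℤ)
    (hθ : ∀ g h a, θ h (A.ρ g⁻¹ a) - θ (g * h) a + θ g a = 0)
    (z : G →₀ A) (hz : z ∈ cycles₁ A) : Finsupp.liftAddHom θ z = 0 := by
  have : Subsingleton (H1 A) := ModuleCat.subsingleton_of_isZero hA
  obtain ⟨c, rfl⟩ := (H1π_eq_zero_iff ⟨z, hz⟩).1 (Subsingleton.elim _ _)
  change Finsupp.liftAddHom θ (d₂₁ A c) = 0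
  induction c using Finsupp.induction_linear with
  | zero => simp
  | add f g hf hg =>
    have := fun h₁ h₂ => congrArg₂ (· + ·) (hf h₁) (hg h₂)
    simp only [map_add]
    rw [hf (d₂₁_apply_mem_cycles₁ f), hg (d₂₁_apply_mem_cycles₁ g), add_zero]
  | single g a =>
    rw [d₂₁_single, map_add, map_sub]
    simpa using! hθ g.1 g.2 a

end Homology

/-! ### Pairings with the Novikov-Sikorav completion -/

section Pairing

variable {G : Type u} [Group G] {φ : G →* Multiplicative ℚ}

theorem finite_support_mul_novikov {θ : G → ℤ} {C : ℝ}
    (hθ : ∀ x, C ≤ (((φ x).toAdd : ℚ) : ℝ) → θ x = 0) (f : novikov φ) :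
    (Function.support fun x => θ x * f.1 x).Finite := by
  refine (f.2 C).subset fun x hx => ⟨right_ne_zero_of_mul hx, ?_⟩
  by_contra! h
  exact left_ne_zero_of_mul hx (hθ x h)

/-- The pairing `f ↦ ∑ₓ θ(x) f(x)` of the Novikov-Sikorav completion with a function `θ` that
vanishes wherever `φ` is large; the sum is finite. -/
noncomputable def novikovPairing (θ : G → ℤ) (C : ℝ)
    (hθ : ∀ x, C ≤ (((φ x).toAdd : ℚ) : ℝ) → θ x = 0) : novikov φ →+ ℤ where
  toFun f := ∑ᶠ x, θ x * f.1 x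
  map_zero' := by simp
  map_add' f g := by
    rw [← finsum_add_distrib (finite_support_mul_novikov hθ f) (finite_support_mul_novikov hθ g)]
    exact finsum_congr fun x => mul_add _ _ _

theorem single_mem_novikov [DecidableEq G] (x : G) : (Pi.single x 1 : G → ℤ) ∈ novikov φ := by
  refine fun C => (Set.finite_singleton x).subset fun y hy => ?_
  by_contra h
  exact hy.1 (Pi.single_eq_of_ne h 1)

theorem ray_mem_novikov {t : G} (ht : 0 < (φ t).toAdd) (x : G) :
    ({y | ∃ n : ℕ, y = t ^ n * x}.indicator 1 : G → ℤ) ∈ novikov φ := by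
  intro C
  have ht' : (0 : ℝ) < (((φ t).toAdd : ℚ) : ℝ) := by exact_mod_cast ht
  obtain ⟨N, hN⟩ := exists_nat_gt ((C - (((φ x).toAdd : ℚ) : ℝ)) / (((φ t).toAdd : ℚ) : ℝ))
  refine ((Set.finite_lt_nat N).image fun n => t ^ n * x).subset ?_
  rintro y ⟨hy, hC⟩
  obtain ⟨n, rfl⟩ := Set.mem_of_indicator_ne_zero hy
  refine ⟨n, ?_, rfl⟩
  have hn : (n : ℝ) < N := by
    refine lt_of_mul_lt_mul_right ?_ ht'.le
    rw [div_lt_iff₀ ht'] at hN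
    simp only [map_mul, map_pow, toAdd_mul, toAdd_pow] at hC
    push_cast [nsmul_eq_mul] at hC
    linarith
  exact_mod_cast hn

/-- The formal sum `x + t x + t² x + ⋯`. -/
noncomputable def novikovRay {t : G} (ht : 0 < (φ t).toAdd) (x : G) : novikov φ :=
  ⟨_, ray_mem_novikov ht x⟩

open Classical in
/-- The group element `x`, seen in the Novikov-Sikorav completion. -/
noncomputable def novikovOf (φ : G →* Multiplicative ℚ) (x : G) : novikov φ :=
  ⟨_, single_mem_novikov x⟩

theorem novikovRep_novikovOf (g x : G) :
    novikovRep φ g (novikovOf φ x) = novikovOf φ (g * x) := by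
  classical
  ext y
  change (Pi.single x 1 : G → ℤ) (g⁻¹ * y) = (Pi.single (g * x) 1 : G → ℤ) y
  simp only [Pi.single_apply, inv_mul_eq_iff_eq_mul]

theorem novikovRep_novikovRay {t : G} (ht : 0 < (φ t).toAdd) (x : G) :
    novikovRep φ t (novikovRay ht x) = novikovRay ht x - novikovOf φ x := by
  classical
  have hinf (n : ℕ) : t ^ (n + 1) * x ≠ x := by
    intro h
    have h₁ : t ^ (n + 1) = 1 := by simpa using h
    have h₂ := congrArg (fun g => (φ g).toAdd) h₁
    simp only [map_pow, map_one, toAdd_pow, toAdd_one, nsmul_eq_mul] at h₂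
    have : (0 : ℚ) < ((n + 1 : ℕ) : ℚ) * (φ t).toAdd := by positivity
    exact this.ne' h₂
  ext y
  change ({y | ∃ n : ℕ, y = t ^ n * x}.indicator 1 : G → ℤ) (t⁻¹ * y) =
    ({y | ∃ n : ℕ, y = t ^ n * x}.indicator 1 : G → ℤ) y - (Pi.single x 1 : G → ℤ) y
  have key : (∃ n : ℕ, t⁻¹ * y = t ^ n * x) ↔ (∃ n : ℕ, y = t ^ n * x) ∧ y ≠ x := by
    constructor
    · rintro ⟨n, hn⟩
      have hy : y = t ^ (n + 1) * x := by
        rw [pow_succ', mul_assoc, ← hn, mul_inv_cancel_left]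
      exact ⟨⟨n + 1, hy⟩, hy ▸ hinf n⟩
    · rintro ⟨⟨n, rfl⟩, hne⟩
      cases n with
      | zero => simp at hne
      | succ n => exact ⟨n, by rw [pow_succ', mul_assoc, inv_mul_cancel_left]⟩
  by_cases hx : y = x
  · subst hx
    have h₁ : ¬ ∃ n : ℕ, t⁻¹ * y = t ^ n * y := fun h => (key.1 h).2 rfl
    have h₂ : ∃ n : ℕ, y = t ^ n * y := ⟨0, by simp⟩
    simp only [Set.indicator_apply, Set.mem_ofPred_eq, h₁, if_false, if_pos h₂, Pi.single_eq_same,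
      Pi.one_apply, sub_self]
  · simp [Set.indicator_apply, key, hx]

theorem novikovPairing_novikovOf (θ : G → ℤ) (C : ℝ)
    (hθ : ∀ x, C ≤ (((φ x).toAdd : ℚ) : ℝ) → θ x = 0) (x : G) :
    novikovPairing θ C hθ (novikovOf φ x) = θ x := by
  classical
  change ∑ᶠ y, θ y * (Pi.single x 1 : G → ℤ) y = θ x
  rw [finsum_eq_single _ x fun y hy => by rw [Pi.single_eq_of_ne hy, mul_zero]]
  simp

/-- If `H₁` with Novikov-Sikorav coefficients vanishes, then a function `l` on the group with the
property that each left translate `l (g⁻¹ x)` agrees with `l x` wherever `φ x` is large, and which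
is invariant under left translation by some `t` with `φ t > 0`, is constant.

The differences `l (g⁻¹ x) - l x` define a 1-cocycle on Novikov chains. It is evaluated on the
1-cycle consisting of an edge from `1` to `s` and of the rays `1, t, t², …` and
`s, ts, t²s, …`. The cocycle vanishes on both rays, so its value on the cycle is `l s - l 1`. -/
theorem eq_of_novikovH1_isZero (hH : CategoryTheory.Limits.IsZero (novikovH1 φ)) {t : G}
    (ht : 0 < (φ t).toAdd) (l : G → ℤ) (hlt : ∀ x, l (t * x) = l x)
    (hl : ∀ g, ∃ C : ℝ, ∀ x, C ≤ (((φ x).toAdd : ℚ) : ℝ) → l (g⁻¹ * x) = l x) (s : G) :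
    l s = l 1 := by
  choose C hC using hl
  let θ (g : G) : novikov φ →+ ℤ := novikovPairing (fun x => l (g⁻¹ * x) - l x) (C g)
    fun x hx => by rw [hC g x hx, sub_self]
  have hfin (g : G) (f : novikov φ) := finite_support_mul_novikov
    (θ := fun x => l (g⁻¹ * x) - l x) (C := C g) (fun x hx => by rw [hC g x hx, sub_self]) f
  have hθ (g h : G) (f : novikov φ) :
      θ h (novikovRep φ g⁻¹ f) - θ (g * h) f + θ g f = 0 := by
    have e₁ : θ h (novikovRep φ g⁻¹ f) =
        ∑ᶠ x, (l (h⁻¹ * (g⁻¹ * x)) - l (g⁻¹ * x)) * f.1 x := by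
      change ∑ᶠ x, (l (h⁻¹ * x) - l x) * f.1 (g⁻¹⁻¹ * x) = _
      rw [← finsum_comp_equiv (Equiv.mulLeft g⁻¹)]
      simp
    have e₂ : θ (g * h) f = θ h (novikovRep φ g⁻¹ f) + θ g f := by
      rw [e₁]
      change ∑ᶠ x, (l ((g * h)⁻¹ * x) - l x) * f.1 x = _ + ∑ᶠ x, (l (g⁻¹ * x) - l x) * f.1 x
      rw [← finsum_add_distrib _ (hfin g f)]
      · refine finsum_congr fun x => ?_
        rw [mul_inv_rev, mul_assoc]
        ring
      · refine ((hfin (g * h) f).union (hfin g f)).subset fun x hx => ?_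
        by_contra hn
        simp only [Set.mem_union, Function.mem_support, not_or, not_not] at hn
        refine hx ?_
        have := congrArg₂ (· - ·) hn.1 hn.2
        simp only [mul_inv_rev, mul_assoc] at this
        linear_combination this
    rw [e₂]
    ring
  let z : G →₀ novikov φ := Finsupp.single s⁻¹ (novikovOf φ 1) +
    Finsupp.single t⁻¹ (novikovRay ht s - novikovRay ht 1)
  have hz : z ∈ groupHomology.cycles₁ (Rep.of (novikovRep φ)) := by
    change groupHomology.d₁₀ (Rep.of (novikovRep φ)) z = 0
    rw [map_add, groupHomology.d₁₀_single, groupHomology.d₁₀_single]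
    change novikovRep φ s⁻¹⁻¹ (novikovOf φ 1) - novikovOf φ 1 +
      (novikovRep φ t⁻¹⁻¹ (novikovRay ht s - novikovRay ht 1) -
        (novikovRay ht s - novikovRay ht 1)) = 0
    rw [inv_inv, inv_inv, map_sub, novikovRep_novikovOf, novikovRep_novikovRay,
      novikovRep_novikovRay, mul_one]
    abel
  have h₀ := cocycle_eval_eq_zero (A := Rep.of (novikovRep φ)) hH θ hθ z hz
  have h₁ : Finsupp.liftAddHom θ z =
      θ s⁻¹ (novikovOf φ 1) + θ t⁻¹ (novikovRay ht s - novikovRay ht 1) := by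
    rw [map_add, Finsupp.liftAddHom_apply_single, Finsupp.liftAddHom_apply_single]
  have h₂ (f : novikov φ) : θ t⁻¹ f = 0 := by
    change ∑ᶠ x, (l (t⁻¹⁻¹ * x) - l x) * f.1 x = 0
    simp [hlt]
  have h₃ : θ s⁻¹ (novikovOf φ 1) = l s - l 1 := by
    simp [θ, novikovPairing_novikovOf]
  rw [h₂, add_zero, h₃] at h₁
  exact sub_eq_zero.1 (h₁.symm.trans h₀)

end Pairing

/-! ### Rational characters of finitely generated groups -/

section Character

variable {G : Type u} [Group G]

/-- A non-zero rational character of a finitely generated group is a positive multiple of a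
surjective integral one. -/
theorem exists_integral_character [Group.FG G] {φ : G →* Multiplicative ℚ} (hφ : φ ≠ 1) :
    ∃ (ψ : G →* Multiplicative ℤ) (t : G) (c : ℚ), (ψ t).toAdd = 1 ∧ 0 < c ∧
      ∀ g, (φ g).toAdd = c * (ψ g).toAdd := by
  classical
  obtain ⟨T, hT⟩ := (Group.FG.out : (⊤ : Subgroup G).FG)
  obtain ⟨D, hD, hint⟩ : ∃ D : ℚ, 0 < D ∧ ∀ g, ∃ n : ℤ, D * (φ g).toAdd = n := by
    refine ⟨∏ g ∈ T, ((φ g).toAdd.den : ℚ),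
      Finset.prod_pos fun g _ => by exact_mod_cast (φ g).toAdd.den_pos, fun g => ?_⟩
    have hg : g ∈ Subgroup.closure (T : Set G) := hT ▸ Subgroup.mem_top g
    induction hg using Subgroup.closure_induction with
    | mem g hg =>
      refine ⟨(∏ x ∈ T.erase g, ((φ x).toAdd.den : ℤ)) * (φ g).toAdd.num, ?_⟩
      rw [← Finset.prod_erase_mul _ _ hg]
      push_cast
      rw [mul_assoc, mul_comm _ (φ g).toAdd, Rat.mul_den_eq_num]
    | one => exact ⟨0, by simp⟩
    | mul g h _ _ hg hh =>
      obtain ⟨m, hm⟩ := hg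
      obtain ⟨n, hn⟩ := hh
      exact ⟨m + n, by rw [map_mul, toAdd_mul, mul_add, hm, hn]; push_cast; rfl⟩
    | inv g _ hg =>
      obtain ⟨m, hm⟩ := hg
      exact ⟨-m, by rw [map_inv, toAdd_inv, mul_neg, hm]; push_cast; rfl⟩
  choose e he using hint
  have he_mul (g h : G) : e (g * h) = e g + e h := by
    have := he (g * h)
    rw [map_mul, toAdd_mul, mul_add, he, he] at this
    exact_mod_cast this.symm
  have he_one : e 1 = 0 := by simpa using he_mul 1 1
  have he_inv (g : G) : e g⁻¹ = -e g := by
    have := he_mul g g⁻¹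
    rw [mul_inv_cancel, he_one] at this
    omega
  let K : AddSubgroup ℤ :=
    { carrier := Set.range e
      zero_mem' := ⟨1, he_one⟩
      add_mem' := by rintro _ _ ⟨g, rfl⟩ ⟨h, rfl⟩; exact ⟨g * h, he_mul g h⟩
      neg_mem' := by rintro _ ⟨g, rfl⟩; exact ⟨g⁻¹, he_inv g⟩ }
  obtain ⟨a, ha⟩ := Int.subgroup_cyclic K
  have hdvd (g : G) : |a| ∣ e g := by
    have hg : e g ∈ AddSubgroup.closure {a} := ha ▸ (⟨g, rfl⟩ : e g ∈ K)
    obtain ⟨n, hn⟩ := AddSubgroup.mem_closure_singleton.1 hg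
    exact (abs_dvd a _).2 ⟨n, by rw [← hn, smul_eq_mul, mul_comm]⟩
  obtain ⟨t, ht⟩ : |a| ∈ K := by
    have haK : a ∈ K := ha ▸ AddSubgroup.subset_closure rfl
    rcases abs_choice a with h | h <;> rw [h]
    exacts [haK, neg_mem haK]
  have ha₀ : 0 < |a| := by
    refine abs_pos.2 fun h => hφ (MonoidHom.ext fun g => Multiplicative.toAdd.injective ?_)
    have h₁ : e g = 0 := by simpa [h] using hdvd g
    have h₂ := he g
    rw [h₁, Int.cast_zero] at h₂
    exact (mul_eq_zero.1 h₂).resolve_left hD.ne'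
  choose q hq using hdvd
  let ψ : G →* Multiplicative ℤ := MonoidHom.mk' (fun g => .ofAdd (q g)) fun g h => by
    rw [← ofAdd_add]
    refine congrArg _ (mul_left_cancel₀ ha₀.ne' ?_)
    rw [mul_add, ← hq, ← hq, ← hq, he_mul]
  have ha₀' : (0 : ℚ) < (|a| : ℤ) := by exact_mod_cast ha₀
  refine ⟨ψ, t, (|a| : ℤ) / D, ?_, div_pos ha₀' hD, fun g => ?_⟩
  · change q t = 1
    refine mul_left_cancel₀ ha₀.ne' ?_
    rw [← hq, ht, mul_one]
  · change (φ g).toAdd = _ * (q g : ℚ)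
    have h := he g
    rw [hq g] at h
    push_cast at h ⊢
    field_simp
    linear_combination h

end Character

/-! ### A finitely generated base group -/

section Generation

variable {G : Type u} [Group G] (ψ : G →* Multiplicative ℤ) (t : G)

/-- The conjugate `t⁻ʰ (g t^(-ψ g)) tʰ`; it lies in the kernel of `ψ` if `ψ t = 1`. -/
def kernelConj (h : ℤ) (g : G) : G :=
  t ^ (-h) * (g * t ^ (-(ψ g).toAdd)) * t ^ h

theorem conj_kernelConj (h : ℤ) (g : G) :
    t * kernelConj ψ t h g * t⁻¹ = kernelConj ψ t (h - 1) g := by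
  unfold kernelConj
  group

/-- If conjugation by high powers of `t⁻¹` eventually moves the kernel parts `g t^(-ψ g)` of the
generators `g` into a subgroup `H`, then it does so for all elements of the group. -/
theorem eventually_kernelConj_mem {T : Set G} (hT : Subgroup.closure T = ⊤) {H : Subgroup G}
    (hH : ∀ g ∈ T, ∃ N : ℤ, ∀ h, N ≤ h → kernelConj ψ t h g ∈ H) (g : G) :
    ∃ N : ℤ, ∀ h, N ≤ h → kernelConj ψ t h g ∈ H := by
  have hg : g ∈ Subgroup.closure T := hT ▸ Subgroup.mem_top g
  induction hg using Subgroup.closure_induction with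
  | mem g hg => exact hH g hg
  | one => exact ⟨0, fun h _ => by simp [kernelConj]⟩
  | mul x y _ _ hx hy =>
    obtain ⟨M, hM⟩ := hx
    obtain ⟨N, hN⟩ := hy
    refine ⟨max M (N + (ψ x).toAdd), fun h hh => ?_⟩
    have : kernelConj ψ t h (x * y) =
        kernelConj ψ t h x * kernelConj ψ t (h - (ψ x).toAdd) y := by
      simp only [kernelConj, map_mul, toAdd_mul]
      group
    rw [this]
    exact H.mul_mem (hM _ (by omega)) (hN _ (by omega))
  | inv x _ hx =>
    obtain ⟨M, hM⟩ := hx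
    refine ⟨M - (ψ x).toAdd, fun h hh => ?_⟩
    have : kernelConj ψ t h x⁻¹ = (kernelConj ψ t (h + (ψ x).toAdd) x)⁻¹ := by
      simp only [kernelConj, map_inv, toAdd_inv]
      group
    rw [this]
    exact H.inv_mem (hM _ (by omega))

variable {ψ t}

/-- If every subgroup that eventually absorbs the conjugates `t⁻ʰ (g t^(-ψ g)) tʰ` contains the
kernel of `ψ`, then the kernel has a finitely generated subgroup `B` with `t B t⁻¹ ≤ B` which
generates the group together with `t`. Here `B` is the closure of `X`. -/
theorem exists_finset_base [Group.FG G] (ht : (ψ t).toAdd = 1)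
    (habs : ∀ H : Subgroup G, (∀ g, ∃ N : ℤ, ∀ h, N ≤ h → kernelConj ψ t h g ∈ H) →
      ψ.ker ≤ H) :
    ∃ X : Finset G, (∀ x ∈ X, (ψ x).toAdd = 0) ∧
      (∀ b ∈ Subgroup.closure (X : Set G), t * b * t⁻¹ ∈ Subgroup.closure (X : Set G)) ∧
      Subgroup.closure (insert t (X : Set G)) = ⊤ := by
  classical
  obtain ⟨T, hT⟩ := (Group.FG.out : (⊤ : Subgroup G).FG)
  have hker (h : ℤ) (g : G) : (ψ (kernelConj ψ t h g)).toAdd = 0 := by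
    simp [kernelConj, ht]
  let H (M : ℕ) : Subgroup G :=
    Subgroup.closure {y | ∃ h : ℕ, 1 ≤ h ∧ h ≤ M ∧ ∃ s ∈ T, y = kernelConj ψ t h s}
  have hmono : Monotone H := fun M N hMN => Subgroup.closure_mono
    fun y ⟨h, h₁, h₂, h₃⟩ => ⟨h, h₁, h₂.trans hMN, h₃⟩
  have hmem (g : G) (hg : g ∈ ψ.ker) : ∃ M, g ∈ H M := by
    rw [← Subgroup.mem_iSup_of_directed hmono.directed_le]
    refine habs _ (eventually_kernelConj_mem ψ t hT fun s hs => ⟨1, fun h hh => ?_⟩) hg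
    lift h to ℕ using by omega
    exact Subgroup.mem_iSup_of_mem h
      (Subgroup.subset_closure ⟨h, by exact_mod_cast hh, le_rfl, s, hs, rfl⟩)
  choose! f hf using hmem
  let M := T.sup fun s => f (kernelConj ψ t 0 s)
  have hM (s : G) (hs : s ∈ T) : kernelConj ψ t 0 s ∈ H M :=
    hmono (Finset.le_sup (f := fun s => f (kernelConj ψ t 0 s)) hs)
      (hf _ (Multiplicative.toAdd.injective (hker 0 s)))
  let X : Finset G := (Finset.range (M + 1) ×ˢ T).image fun p => kernelConj ψ t p.1 p.2
  have hX (h : ℕ) (hh : h ≤ M) (s : G) (hs : s ∈ T) :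
      kernelConj ψ t h s ∈ X :=
    Finset.mem_image.2 ⟨(h, s), by simp [hs]; omega, rfl⟩
  have hconj {Y : Set G} {B : Subgroup G} (hY : ∀ y ∈ Y, t * y * t⁻¹ ∈ B) :
      ∀ y ∈ Subgroup.closure Y, t * y * t⁻¹ ∈ B := by
    have : Subgroup.closure Y ≤ B.comap (MulAut.conj t).toMonoidHom :=
      (Subgroup.closure_le _).2 fun y hy => by simpa using hY y hy
    exact fun y hy => by simpa using this hy
  -- conjugating by `t` lowers the exponents of the generators by one
  have hstep (h : ℕ) (h₁ : 1 ≤ h) (h₂ : h ≤ M) (s : G) (hs : s ∈ T) :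
      t * kernelConj ψ t h s * t⁻¹ ∈ Subgroup.closure (X : Set G) := by
    rw [conj_kernelConj, show (h : ℤ) - 1 = ((h - 1 : ℕ) : ℤ) by omega]
    exact Subgroup.subset_closure (hX _ (by omega) s hs)
  refine ⟨X, fun x hx => ?_, hconj fun x hx => ?_, ?_⟩
  · obtain ⟨p, -, rfl⟩ := Finset.mem_image.1 hx
    exact hker _ _
  · obtain ⟨⟨h, s⟩, hp, rfl⟩ := Finset.mem_image.1 hx
    simp only [Finset.mem_product, Finset.mem_range] at hp
    rcases Nat.eq_zero_or_pos h with rfl | hpos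
    · refine hconj ?_ _ (hM s hp.2)
      rintro _ ⟨h, h₁, h₂, s, hs, rfl⟩
      exact hstep h h₁ h₂ s hs
    · exact hstep h hpos (by omega) s hp.2
  · rw [eq_top_iff, ← hT, Subgroup.closure_le]
    intro s hs
    have : s = kernelConj ψ t 0 s * t ^ (ψ s).toAdd := by simp [kernelConj]
    rw [this]
    have hs' : kernelConj ψ t 0 s ∈ Subgroup.closure (insert t (X : Set G)) :=
      Subgroup.subset_closure (Or.inr (hX 0 (by omega) s hs))
    have ht' : t ∈ Subgroup.closure (insert t (X : Set G)) :=
      Subgroup.subset_closure (Or.inl rfl)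
    exact mul_mem hs' (zpow_mem ht' _)

end Generation

/-! ### Normal forms in ascending HNN extensions -/

section HNN

variable {B : Type u} [Group B] (γ : B →* B) (hγ : Function.Injective γ)

/-- The isomorphism from the whole group `B` onto the image of an injective endomorphism, as it
enters the ascending HNN extension `⟨B, t | t b t⁻¹ = γ b⟩`. -/
noncomputable def ascendingEquiv : (⊤ : Subgroup B) ≃* γ.range :=
  Subgroup.topEquiv.trans (MonoidHom.ofInjective hγ)

open HNNExtension

theorem t_mul_of_ascending (b : B) :
    t * (of b : HNNExtension B ⊤ γ.range (ascendingEquiv γ hγ)) = of (γ b) * t :=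
  t_mul_of (⟨b, trivial⟩ : (⊤ : Subgroup B))

theorem exists_pow_mul_of (n : ℕ) (b : B) : ∃ b' : B,
    t ^ n * (of b : HNNExtension B ⊤ γ.range (ascendingEquiv γ hγ)) = of b' * t ^ n := by
  induction n with
  | zero => exact ⟨b, by simp⟩
  | succ n ih =>
    obtain ⟨b', hb'⟩ := ih
    exact ⟨γ b', by rw [pow_succ', mul_assoc, hb', ← mul_assoc, t_mul_of_ascending, mul_assoc]⟩

/-- In an ascending HNN extension all positive powers of the stable letter can be moved to the
right and all negative ones to the left. -/
theorem exists_normal_form (x : HNNExtension B ⊤ γ.range (ascendingEquiv γ hγ)) :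
    ∃ (n : ℕ) (b : B) (m : ℕ), x = (t ^ n)⁻¹ * of b * t ^ m := by
  induction x using HNNExtension.induction_on with
  | of b => exact ⟨0, b, 0, by simp⟩
  | t => exact ⟨0, 1, 1, by simp⟩
  | mul x y hx hy =>
    obtain ⟨n, b, m, rfl⟩ := hx
    obtain ⟨p, c, q, rfl⟩ := hy
    rcases le_total p m with h | h
    · obtain ⟨k, rfl⟩ := Nat.exists_eq_add_of_le' h
      obtain ⟨c', hc'⟩ := exists_pow_mul_of γ hγ k c
      refine ⟨n, b * c', k + q, ?_⟩
      calc _ = (t ^ n)⁻¹ * of b * (t ^ k * of c) * t ^ q := by rw [pow_add]; group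
        _ = _ := by rw [hc', map_mul, pow_add]; group
    · obtain ⟨k, rfl⟩ := Nat.exists_eq_add_of_le' h
      obtain ⟨b', hb'⟩ := exists_pow_mul_of γ hγ k b
      refine ⟨k + n, b' * c, q, ?_⟩
      have hb'' : of b * (t ^ k)⁻¹ =
          (t ^ k)⁻¹ * (of b' : HNNExtension B ⊤ γ.range (ascendingEquiv γ hγ)) := by
        rw [eq_inv_mul_iff_mul_eq, ← mul_assoc, hb', mul_inv_cancel_right]
      calc _ = (t ^ n)⁻¹ * (of b * (t ^ k)⁻¹) * of c * t ^ q := by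
            rw [add_comm k m, pow_add]; group
        _ = _ := by rw [hb'', map_mul, pow_add]; group
  | inv x hx =>
    obtain ⟨n, b, m, rfl⟩ := hx
    exact ⟨m, b⁻¹, n, by rw [map_inv]; group⟩

end HNN

/-! ### Consequences of an ascending base group -/

section Ascending

open scoped commutatorElement

variable {G : Type u} [Group G] {φ : G →* Multiplicative ℚ} {t : G}

theorem isRepresentedByAscendingHNN_of_base (ht : 0 < (φ t).toAdd) {B : Subgroup G}
    (hB : Group.FG B) (hφB : ∀ b ∈ B, (φ b).toAdd = 0) (hconj : ∀ b ∈ B, t * b * t⁻¹ ∈ B)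
    (hgen : B ⊔ Subgroup.zpowers t = ⊤) : IsRepresentedByAscendingHNN φ := by
  let γ : B →* B := ((MulAut.conj t).toMonoidHom.comp B.subtype).codRestrict B
    fun b => hconj b b.2
  have hγ : Function.Injective γ := fun b c h => by
    have := congrArg Subtype.val h
    exact Subtype.ext ((MulAut.conj t).injective this)
  let F : HNNExtension B ⊤ γ.range (ascendingEquiv γ hγ) →* G :=
    HNNExtension.lift B.subtype t fun a => by
      change t * (a : B) = t * (a : B) * t⁻¹ * t
      group
  have hFt : F HNNExtension.t = t := HNNExtension.lift_t _ _ _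
  have hFof (b : B) : F (HNNExtension.of b) = b := HNNExtension.lift_of _ _ _ _
  have hinj : Function.Injective F := by
    refine (injective_iff_map_eq_one F).2 fun x hx => ?_
    obtain ⟨n, b, m, rfl⟩ := exists_normal_form γ hγ x
    simp only [map_mul, map_inv, map_pow, hFt, hFof] at hx
    have hnm : n = m := by
      have := congrArg (fun g => (φ g).toAdd) hx
      simp only [map_mul, map_inv, map_pow, toAdd_mul, toAdd_inv, toAdd_pow, hφB b b.2, map_one,
        toAdd_one, nsmul_eq_mul, add_zero] at this
      have h : (n : ℚ) = m := mul_right_cancel₀ ht.ne' (by linarith)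
      exact_mod_cast h
    subst hnm
    have hb : b = 1 := by
      have h : (t ^ n)⁻¹ * (b : G) * ((t ^ n)⁻¹)⁻¹ = 1 := by rwa [inv_inv]
      exact Subtype.ext (conj_eq_one_iff.1 h)
    simp [hb]
  have hsurj : Function.Surjective F := by
    rw [← MonoidHom.range_eq_top, eq_top_iff, ← hgen, sup_le_iff, Subgroup.zpowers_le]
    exact ⟨fun b hb => ⟨HNNExtension.of ⟨b, hb⟩, hFof _⟩, ⟨HNNExtension.t, hFt⟩⟩
  let e := MulEquiv.ofBijective F ⟨hinj, hsurj⟩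
  have he (x) : e.symm.symm x = F x := rfl
  refine ⟨B, inferInstance, ⊤, γ.range, ascendingEquiv γ hγ, e.symm, hB, rfl, ?_, fun b => ?_⟩
  · rwa [he, hFt]
  · rw [he, hFof]
    exact hφB b b.2

/-- For `x` fixed, the elements `g` of a group `N` normalizing `H` for which `⁅g, x⁆ ∈ H` form a
subgroup. Here `N` is the closure of `Y`. -/
theorem commutator_mem_of_closure {Y : Set G} {H : Subgroup G}
    (hH : ∀ g ∈ Subgroup.closure Y, ∀ y ∈ H, g * y * g⁻¹ ∈ H) {x : G}
    (hx : ∀ y ∈ Y, ⁅y, x⁆ ∈ H) {g : G} (hg : g ∈ Subgroup.closure Y) : ⁅g, x⁆ ∈ H := by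
  induction hg using Subgroup.closure_induction with
  | mem y hy => exact hx y hy
  | one => simp
  | mul a b ha _ iha ihb =>
    have : ⁅a * b, x⁆ = a * ⁅b, x⁆ * a⁻¹ * ⁅a, x⁆ := by simp only [commutatorElement_def]; group
    rw [this]
    exact H.mul_mem (hH a ha _ ihb) iha
  | inv a ha iha =>
    have : ⁅a⁻¹, x⁆ = a⁻¹ * ⁅a, x⁆⁻¹ * a⁻¹⁻¹ := by simp only [commutatorElement_def]; group
    rw [this]
    exact hH _ (inv_mem ha) _ (H.inv_mem iha)

theorem commutator_mem_of_closure_closure {Y Z : Set G} {H : Subgroup G}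
    (hHY : ∀ g ∈ Subgroup.closure Y, ∀ y ∈ H, g * y * g⁻¹ ∈ H)
    (hHZ : ∀ g ∈ Subgroup.closure Z, ∀ y ∈ H, g * y * g⁻¹ ∈ H)
    (h : ∀ y ∈ Y, ∀ z ∈ Z, ⁅y, z⁆ ∈ H) {g k : G} (hg : g ∈ Subgroup.closure Y)
    (hk : k ∈ Subgroup.closure Z) : ⁅g, k⁆ ∈ H := by
  refine commutator_mem_of_closure hHY (fun y hy => ?_) hg
  rw [← commutatorElement_inv]
  refine H.inv_mem (commutator_mem_of_closure hHZ (fun z hz => ?_) hk)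
  rw [← commutatorElement_inv]
  exact H.inv_mem (h y hy z hz)

/-- If `X` generates a subgroup `B ≤ ker φ` with `t B t⁻¹ ≤ B` and `φ t > 0`, then the submonoid
generated by `B` and `t` turns the commutators of the elements of `X ∪ {t}` into a generating set
of the commutator subgroup. -/
theorem mem_bnsInvariant_of_base (ht : 0 < (φ t).toAdd) {X : Finset G}
    (hφX : ∀ x ∈ X, (φ x).toAdd = 0)
    (hconj : ∀ b ∈ Subgroup.closure (X : Set G), t * b * t⁻¹ ∈ Subgroup.closure (X : Set G))
    (hgen : Subgroup.closure (insert t (X : Set G)) = ⊤) : φ ∈ bnsInvariant G := by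
  classical
  set B := Subgroup.closure (X : Set G) with hB
  let Y : Finset G := insert t (X ∪ X.image (·⁻¹))
  let P : Submonoid G := Submonoid.closure (Y : Set G)
  let F : Finset G := Finset.image₂ (fun a b => ⁅a, b⁆) X (insert t X)
  let H : Subgroup G := Subgroup.closure {y : G | ∃ p ∈ P, ∃ x ∈ F, y = p⁻¹ * x * p}
  have htP : t ∈ P := Submonoid.subset_closure (by simp [Y])
  have hBP : ∀ b ∈ B, b ∈ P := by
    intro b hb
    rw [hB, ← Subgroup.mem_toSubmonoid, Subgroup.closure_toSubmonoid] at hb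
    refine Submonoid.closure_mono ?_ hb
    rintro y (hy | hy)
    · simp [Y, Finset.mem_coe.1 hy]
    · have : y⁻¹ ∈ X := hy
      simp [Y, this]
  have hconjN (n : ℕ) (b : G) (hb : b ∈ B) : t ^ n * b * (t ^ n)⁻¹ ∈ B := by
    induction n with
    | zero => simpa
    | succ n ih =>
      have := hconj _ ih
      rwa [show t * (t ^ n * b * (t ^ n)⁻¹) * t⁻¹ = t ^ (n + 1) * b * (t ^ (n + 1))⁻¹ by
        rw [pow_succ']; group] at this
  -- every element of `P` can be written as `b tⁿ`
  have hPform : ∀ p ∈ P, ∃ b ∈ B, ∃ n : ℕ, p = b * t ^ n := by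
    intro p hp
    induction hp using Submonoid.closure_induction with
    | mem y hy =>
      simp only [Y, Finset.coe_insert, Finset.coe_union, Finset.coe_image, Set.mem_insert_iff,
        Set.mem_union, Set.mem_image, Finset.mem_coe] at hy
      rcases hy with hy | hy | ⟨x, hx, rfl⟩
      · exact ⟨1, one_mem _, 1, by simp [hy]⟩
      · exact ⟨y, Subgroup.subset_closure hy, 0, by simp⟩
      · exact ⟨x⁻¹, inv_mem (Subgroup.subset_closure hx), 0, by simp⟩
    | one => exact ⟨1, one_mem _, 0, by simp⟩
    | mul p q _ _ hp hq =>
      obtain ⟨b, hb, n, rfl⟩ := hp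
      obtain ⟨c, hc, m, rfl⟩ := hq
      refine ⟨b * (t ^ n * c * (t ^ n)⁻¹), mul_mem hb (hconjN n c hc), n + m, ?_⟩
      rw [pow_add]
      group
  have hφB : ∀ b ∈ B, (φ b).toAdd = 0 := by
    have : B ≤ φ.ker := (Subgroup.closure_le _).2 fun x hx =>
      Multiplicative.toAdd.injective (hφX x hx)
    exact fun b hb => congrArg Multiplicative.toAdd (this hb)
  have hconjH {g : G} (hg : ∀ p ∈ P, ∀ x ∈ F, g * (p⁻¹ * x * p) * g⁻¹ ∈ H) :
      ∀ y ∈ H, g * y * g⁻¹ ∈ H := by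
    have : H ≤ H.comap (MulAut.conj g).toMonoidHom := (Subgroup.closure_le _).2 <| by
      rintro _ ⟨p, hp, x, hx, rfl⟩
      simpa using hg p hp x hx
    exact fun y hy => by simpa using this hy
  have hHP : ∀ p ∈ P, ∀ y ∈ H, p⁻¹ * y * p ∈ H := by
    intro p hp y hy
    have := hconjH (g := p⁻¹) (fun q hq x hx => Subgroup.subset_closure
      ⟨q * p, mul_mem hq hp, x, hx, by group⟩) y hy
    rwa [inv_inv] at this
  have hHB : ∀ b ∈ B, ∀ y ∈ H, b * y * b⁻¹ ∈ H := fun b hb y hy => by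
    simpa using hHP b⁻¹ (hBP _ (inv_mem hb)) y hy
  have hF {a b : G} (ha : a ∈ X) (hb : b ∈ insert t X) : ⁅a, b⁆ ∈ H :=
    Subgroup.subset_closure ⟨1, one_mem _, _, Finset.mem_image₂_of_mem ha hb, by simp⟩
  have hBt : ∀ b ∈ B, ⁅b, t⁆ ∈ H := fun b hb =>
    commutator_mem_of_closure hHB (fun x hx => hF hx (Finset.mem_insert_self _ _)) hb
  have hBB : ∀ b ∈ B, ∀ c ∈ B, ⁅b, c⁆ ∈ H := fun b hb c hc =>
    commutator_mem_of_closure_closure hHB hHB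
      (fun x hx y hy => hF hx (Finset.mem_insert_of_mem hy)) hb hc
  -- Conjugation by `t` keeps the elements `p⁻¹ x p` with `p = b tⁿ` in `H`: for `n > 0` it lowers
  -- `n`, and for `n = 0` it carries a commutator `⁅b, c⁆` to `⁅t b t⁻¹, t c t⁻¹⁆`.
  have hHt : ∀ y ∈ H, t * y * t⁻¹ ∈ H := by
    refine hconjH fun p hp x hx => ?_
    obtain ⟨b, hb, n, rfl⟩ := hPform p hp
    rcases n with _ | n
    · have hx' : t * x * t⁻¹ ∈ H := by
        obtain ⟨a, ha, c, hc, rfl⟩ := Finset.mem_image₂.1 hx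
        have ha' := hconj a (Subgroup.subset_closure ha)
        have : t * ⁅a, c⁆ * t⁻¹ = ⁅t * a * t⁻¹, t * c * t⁻¹⁆ := by
          simp only [commutatorElement_def]; group
        rw [this]
        rcases Finset.mem_insert.1 hc with rfl | hc
        · rw [mul_inv_cancel_right]
          exact hBt _ ha'
        · exact hBB _ ha' _ (hconj c (Subgroup.subset_closure hc))
      have := hHB _ (inv_mem (hconj b hb)) _ hx'
      convert! this using 1
      group
    · refine Subgroup.subset_closure ⟨b * t ^ n, mul_mem (hBP b hb) (pow_mem htP n), x, hx, ?_⟩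
      rw [pow_succ]
      group
  have hnorm : ∀ g : G, ∀ y ∈ H, g * y * g⁻¹ ∈ H := by
    have hN : Subgroup.closure (insert t (X : Set G)) ≤ Subgroup.normalizer (H : Set G) := by
      refine (Subgroup.closure_le _).2 ?_
      rintro g (rfl | hg)
      · refine Subgroup.mem_normalizer_iff.2 fun y => ⟨hHt y, fun hy => ?_⟩
        have := hHP _ htP _ hy
        simpa [mul_assoc] using this
      · have hg' : g ∈ B := Subgroup.subset_closure hg
        refine Subgroup.mem_normalizer_iff.2 fun y => ⟨hHB g hg' y, fun hy => ?_⟩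
        have := hHP _ (hBP g hg') _ hy
        simpa [mul_assoc] using this
    intro g y hy
    exact (Subgroup.mem_normalizer_iff.1 (hN (hgen ▸ Subgroup.mem_top g)) y).1 hy
  have hall (g k : G) : ⁅g, k⁆ ∈ H := by
    refine commutator_mem_of_closure_closure (Y := insert t (X : Set G))
      (Z := insert t (X : Set G)) (fun g _ => hnorm g) (fun g _ => hnorm g) ?_
      (hgen ▸ Subgroup.mem_top g) (hgen ▸ Subgroup.mem_top k)
    rintro a (rfl | ha) b hb
    · rcases hb with rfl | hb
      · simp
      · rw [← commutatorElement_inv]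
        exact H.inv_mem (hBt b (Subgroup.subset_closure hb))
    · exact hF ha (by simpa using hb)
  have hFcomm : ∀ x ∈ F, x ∈ commutator G := by
    intro x hx
    obtain ⟨a, -, b, -, rfl⟩ := Finset.mem_image₂.1 hx
    exact Subgroup.commutator_mem_commutator (Subgroup.mem_top a) (Subgroup.mem_top b)
  refine ⟨?_, P, ⟨Y, rfl⟩, ?_, F, hFcomm, le_antisymm ?_ ?_⟩
  · rintro rfl
    simp at ht
  · intro p hp
    obtain ⟨b, hb, n, rfl⟩ := hPform p hp
    rw [map_mul, map_pow, toAdd_mul, toAdd_pow, hφB b hb, zero_add]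
    exact nsmul_nonneg ht.le n
  · refine (Subgroup.closure_le _).2 ?_
    rintro _ ⟨p, -, x, hx, rfl⟩
    simpa using (inferInstance : (commutator G).Normal).conj_mem x (hFcomm x hx) p⁻¹
  · exact Subgroup.commutator_le.2 fun g _ k _ => hall g k

end Ascending

/-! ### Groups with vanishing first Novikov-Sikorav homology -/

theorem fg_of_isFinitelyPresented (G : Type u) [Group G] [Group.IsFinitelyPresented G] :
    Group.FG G := by
  obtain ⟨n, f, hf, -⟩ := Group.IsFinitelyPresented.out (G := G)
  exact Group.fg_of_surjective hf

/-- If `H₁` with Novikov-Sikorav coefficients vanishes, a subgroup `H` which eventually absorbs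
the conjugates `t⁻ʰ (g t^(-ψ g)) tʰ` of the kernel part of each `g` contains the whole kernel:
the indicator function of `t^(-ψ x) x ∈ H` is constant. -/
theorem ker_le_of_eventually_kernelConj_mem {G : Type u} [Group G] {φ : G →* Multiplicative ℚ}
    (hH : CategoryTheory.Limits.IsZero (novikovH1 φ)) {ψ : G →* Multiplicative ℤ} {t : G} {c : ℚ}
    (ht : (ψ t).toAdd = 1) (hc : 0 < c) (hφψ : ∀ g, (φ g).toAdd = c * (ψ g).toAdd)
    (H : Subgroup G) (habs : ∀ g, ∃ N : ℤ, ∀ h, N ≤ h → kernelConj ψ t h g ∈ H) :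
    ψ.ker ≤ H := by
  classical
  let l (x : G) : ℤ := if t ^ (-(ψ x).toAdd) * x ∈ H then 1 else 0
  have hφt : 0 < (φ t).toAdd := by
    rw [hφψ, ht]
    simpa
  have hlt (x : G) : l (t * x) = l x := by
    have : t ^ (-(ψ (t * x)).toAdd) * (t * x) = t ^ (-(ψ x).toAdd) * x := by
      rw [map_mul, toAdd_mul, ht]
      group
    simp only [l, this]
  have hl (g : G) : ∃ C : ℝ, ∀ x, C ≤ (((φ x).toAdd : ℚ) : ℝ) → l (g⁻¹ * x) = l x := by
    obtain ⟨N, hN⟩ := habs g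
    refine ⟨((c * N : ℚ) : ℝ), fun x hx => ?_⟩
    have hNx : N ≤ (ψ x).toAdd := by
      rw [Rat.cast_le, hφψ] at hx
      exact_mod_cast le_of_mul_le_mul_left hx hc
    have : t ^ (-(ψ (g⁻¹ * x)).toAdd) * (g⁻¹ * x) =
        (kernelConj ψ t (ψ x).toAdd g)⁻¹ * (t ^ (-(ψ x).toAdd) * x) := by
      simp only [kernelConj, map_mul, map_inv, toAdd_mul, toAdd_inv]
      group
    simp only [l, this, Subgroup.mul_mem_cancel_left H (H.inv_mem (hN _ hNx))]
  intro s hs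
  have h₁ := eq_of_novikovH1_isZero hH hφt l hlt hl s
  have h₂ : ψ s = 1 := hs
  by_contra hn
  simp [l, h₂, hn] at h₁

theorem theorem3p2 {π : Type u} [Group π] [Group.IsFinitelyPresented π]
    (φ : π →* Multiplicative ℚ) (hφ : φ ≠ 1)
    (hH : CategoryTheory.Limits.IsZero (novikovH1 φ)) :
    φ ∈ bnsInvariant π ∧ IsRepresentedByAscendingHNN φ := by
  have := fg_of_isFinitelyPresented π
  obtain ⟨ψ, t, c, ht, hc, hφψ⟩ := exists_integral_character hφ
  obtain ⟨X, hX, hconj, hgen⟩ := exists_finset_base ht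
    (ker_le_of_eventually_kernelConj_mem hH ht hc hφψ)
  have hφt : 0 < (φ t).toAdd := by
    rw [hφψ, ht]
    simpa
  have hφX : ∀ x ∈ X, (φ x).toAdd = 0 := fun x hx => by simp [hφψ, hX x hx]
  have hφB : Subgroup.closure (X : Set π) ≤ φ.ker := (Subgroup.closure_le _).2 fun x hx =>
    Multiplicative.toAdd.injective (hφX x hx)
  refine ⟨mem_bnsInvariant_of_base hφt hφX hconj hgen,
    isRepresentedByAscendingHNN_of_base hφt ((Group.fg_iff_subgroup_fg _).2 ⟨X, rfl⟩)
      (fun b hb => congrArg Multiplicative.toAdd (hφB hb)) hconj ?_⟩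
  rw [eq_top_iff, ← hgen, Subgroup.closure_le]
  rintro x (rfl | hx)
  · exact Subgroup.mem_sup_right (Subgroup.mem_zpowers x)
  · exact Subgroup.mem_sup_left (Subgroup.subset_closure hx)
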